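/- Theorem. Let $m,n$ be nonnegative integers, let $A,V,Q\in\mathbb{C}^{n\times n}$, $B\in\mathbb{C}^{n\times m}$, $R\in\mathbb{C}^{m\times m}$, where $V,Q,R$ are Hermitian positive definite, and let $\gamma>0$ and $w_1,\dots,w_m>0$. Assume that the operator $\mathcal{A}_1(X)=AX+XA^*$ on $\mathbb{C}^{n\times n}$ is invertible. Put $\mathcal{B}(Y)=BY+Y^*B^*$ and $X(Y)=\mathcal{A}_1^{-1}(\mathcal{B}(Y)-V)$ for $Y\in\mathbb{C}^{m\times n}$, and let $$\mathcal{D}_s=\{Y\in\mathbb{C}^{m\times n} : \mathcal{A}_1(X(Y))-\mathcal{B}(Y)=-V,\ X(Y)\succ 0\},$$ $$f(Y)=\operatorname{tr}\big(Q\,X(Y)+Y^*RY\,X(Y)^{-1}\big),\qquad g(Y)=\sum_{i=1}^m w_i\,\|e_i^*Y\|_2,$$ $$\mathcal{D}(a)=\{Y\in\mathcal{D}_s : f(Y)\le a\}.$$ The space $\mathbb{C}^{m\times n}$ carries the Frobenius norm $\|\cdot\|_F$, and gradients are taken with respect to the real inner product $\operatorname{Re}\operatorname{tr}(M_1^*M_2)$.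 The actuator-selection problem is to minimize $f(Y)+\gamma g(Y)$ over $Y\in\mathcal{D}_s$. Let $Y^0\in\mathcal{D}_s$ and let $a>f(Y^0)+\gamma g(Y^0)$. Then: 1. There is $\mu_a>0$ such that $f$ is strongly convex with modulus $\mu_a$ on $\mathcal{D}(a)$ (in particular $\mathcal{D}(a)$ is convex), and there is $L_a>0$ such that $f$ is differentiable at every point of $\mathcal{D}(a)$ and $\nabla f$ is $L_a$-Lipschitz on $\mathcal{D}(a)$. The problem has a unique globally optimal solution $Y^\star\in\mathcal{D}_s$. 2. For any such constants $\mu_a,L_a>0$ and any step-size $\alpha\in[0,1/L_a]$, the proximal gradient iterates started at $Y^0$, $$Y^{k+1}=\operatorname{prox}_{\gamma\alpha g}\big(Y^k-\alpha\nabla f(Y^k)\big),\qquad \operatorname{prox}_h(W)=\operatorname*{arg\,min}_{Z\in\mathbb{C}^{m\times n}}\Big(h(Z)+\tfrac12\|Z-W\|_F^2\Big),$$ are well defined, remain in $\mathcal{D}(a)$, and satisfy for every $k\ge 0$ $$\|Y^{k+1}-Y^\star\|_F^2\le(1-\mu_a\alpha)\,\|Y^k-Y^\star\|_F^2.$$ 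-/

import Mathlib

open Matrix
open scoped ComplexOrder

attribute [local instance] Matrix.frobeniusNormedAddCommGroup Matrix.frobeniusNormedSpace

noncomputable section

namespace ActuatorSelection

/-- The Lyapunov operator `𝒜₁ X = A X + X A*`. -/
def lyapOp {n : ℕ} (A : Matrix (Fin n) (Fin n) ℂ) :
    Module.End ℂ (Matrix (Fin n) (Fin n) ℂ) where
  toFun X := A * X + X * Aᴴ
  map_add' X Z := by rw [mul_add, add_mul]; abel
  map_smul' c X := by simp [smul_add]

/-- The (real-linear) operator `ℬ Y = B Y + Y* B*`. -/
def inputOp {m n : ℕ} (B : Matrix (Fin n) (Fin m) ℂ) (Y : Matrix (Fin m) (Fin n) ℂ) :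
    Matrix (Fin n) (Fin n) ℂ :=
  B * Y + Yᴴ * Bᴴ

/-- The state covariance `X(Y) = 𝒜₁⁻¹ (ℬ Y - V)`; meaningful when `𝒜₁` is invertible. -/
def stateCov {m n : ℕ} (A : Matrix (Fin n) (Fin n) ℂ) (B : Matrix (Fin n) (Fin m) ℂ)
    (V : Matrix (Fin n) (Fin n) ℂ) (Y : Matrix (Fin m) (Fin n) ℂ) :
    Matrix (Fin n) (Fin n) ℂ :=
  Ring.inverse (lyapOp A) (inputOp B Y - V)

/-- The domain `𝒟ₛ` of matrices `Y` that correspond to stabilizing feedback gains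
`K = Y X(Y)⁻¹`. -/
def stabDomain {m n : ℕ} (A : Matrix (Fin n) (Fin n) ℂ) (B : Matrix (Fin n) (Fin m) ℂ)
    (V : Matrix (Fin n) (Fin n) ℂ) : Set (Matrix (Fin m) (Fin n) ℂ) :=
  {Y | lyapOp A (stateCov A B V Y) - inputOp B Y = -V ∧ (stateCov A B V Y).PosDef}

/-- The smooth part `f(Y) = tr (Q X(Y) + Y* R Y X(Y)⁻¹)`. The trace is a real number for `Y` in
`𝒟ₛ` (with `Q`, `R` Hermitian); the real part makes `f` real-valued. -/
def smoothCost {m n : ℕ} (A : Matrix (Fin n) (Fin n) ℂ) (B : Matrix (Fin n) (Fin m) ℂ)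
    (V Q : Matrix (Fin n) (Fin n) ℂ) (R : Matrix (Fin m) (Fin m) ℂ)
    (Y : Matrix (Fin m) (Fin n) ℂ) : ℝ :=
  (Q * stateCov A B V Y + Yᴴ * R * Y * (stateCov A B V Y)⁻¹).trace.re

/-- The regularizer `g(Y) = ∑ᵢ wᵢ ‖eᵢ* Y‖₂`, a weighted sum of Euclidean norms of rows. -/
def rowReg {m n : ℕ} (w : Fin m → ℝ) (Y : Matrix (Fin m) (Fin n) ℂ) : ℝ :=
  ∑ i, w i * ‖(WithLp.toLp 2 (Y i) : EuclideanSpace ℂ (Fin n))‖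

/-- The sublevel set `𝒟(a) = {Y ∈ 𝒟ₛ | f(Y) ≤ a}`. -/
def sublevel {m n : ℕ} (A : Matrix (Fin n) (Fin n) ℂ) (B : Matrix (Fin n) (Fin m) ℂ)
    (V Q : Matrix (Fin n) (Fin n) ℂ) (R : Matrix (Fin m) (Fin m) ℂ) (a : ℝ) :
    Set (Matrix (Fin m) (Fin n) ℂ) :=
  {Y | Y ∈ stabDomain A B V ∧ smoothCost A B V Q R Y ≤ a}

/-- The gradient of a real function of a complex matrix, with respect to the real inner product
`Re tr (M₁* M₂)`, which induces the Frobenius norm. Its entries are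
`∂f/∂(Re Yᵢⱼ) + i ∂f/∂(Im Yᵢⱼ)`; see `re_trace_matGrad`. -/
def matGrad {m n : ℕ} (f : Matrix (Fin m) (Fin n) ℂ → ℝ) (Y : Matrix (Fin m) (Fin n) ℂ) :
    Matrix (Fin m) (Fin n) ℂ :=
  Matrix.of fun i j =>
    ⟨fderiv ℝ f Y (Matrix.single i j 1), fderiv ℝ f Y (Matrix.single i j Complex.I)⟩

/-- The defining property of the gradient: it represents the derivative. -/
theorem re_trace_matGrad {m n : ℕ} (f : Matrix (Fin m) (Fin n) ℂ → ℝ)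
    (Y H : Matrix (Fin m) (Fin n) ℂ) :
    ((matGrad f Y)ᴴ * H).trace.re = fderiv ℝ f Y H := by
  conv_rhs => rw [Matrix.matrix_eq_sum_single H]
  simp only [map_sum]
  have key : ∀ i j, fderiv ℝ f Y (Matrix.single i j (H i j)) =
      (H i j).re * fderiv ℝ f Y (Matrix.single i j 1) +
      (H i j).im * fderiv ℝ f Y (Matrix.single i j Complex.I) := by
    intro i j
    have : Matrix.single i j (H i j) = (H i j).re • Matrix.single i j (1 : ℂ) +
        (H i j).im • Matrix.single i j Complex.I := by
      rw [Matrix.smul_single, Matrix.smul_single, ← Matrix.single_add]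
      congr 1
      apply Complex.ext <;> simp
    rw [this, map_add, map_smul, map_smul, smul_eq_mul, smul_eq_mul]
  simp only [key, Matrix.trace, Matrix.diag, Matrix.mul_apply, Complex.re_sum,
    Matrix.conjTranspose_apply, matGrad, Matrix.of_apply]
  rw [Finset.sum_comm]
  refine Finset.sum_congr rfl fun i _ => Finset.sum_congr rfl fun j _ => ?_
  simp [Complex.mul_re]
  ring

/-- `f` is differentiable at the points of `s` and its gradient is `L`-Lipschitz on `s`, in the
Frobenius norm. -/
def IsSmoothOn {m n : ℕ} (f : Matrix (Fin m) (Fin n) ℂ → ℝ)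
    (s : Set (Matrix (Fin m) (Fin n) ℂ)) (L : ℝ) : Prop :=
  (∀ Y ∈ s, DifferentiableAt ℝ f Y) ∧
    ∀ Y ∈ s, ∀ Z ∈ s, ‖matGrad f Y - matGrad f Z‖ ≤ L * ‖Y - Z‖

/-- `P` is a minimizer of `h(Z) + ½ ‖Z - W‖_F²`, that is, `P = prox_h (W)`. -/
def IsProx {m n : ℕ} (h : Matrix (Fin m) (Fin n) ℂ → ℝ)
    (W P : Matrix (Fin m) (Fin n) ℂ) : Prop :=
  IsMinOn (fun Z => h Z + 1 / 2 * ‖Z - W‖ ^ 2) Set.univ P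

/-- `Y 0, Y 1, …` are the proximal gradient iterates for `f + γ g` with fixed step-size `α`,
started at `Y0`. -/
def IsProxGradSeq {m n : ℕ} (f g : Matrix (Fin m) (Fin n) ℂ → ℝ) (γ α : ℝ)
    (Y0 : Matrix (Fin m) (Fin n) ℂ) (Y : ℕ → Matrix (Fin m) (Fin n) ℂ) : Prop :=
  Y 0 = Y0 ∧
    ∀ k, IsProx (fun Z => γ * α * g Z) (Y k - α • matGrad f (Y k)) (Y (k + 1))

/-- `Ys` is a globally optimal solution of: minimize `f(Y) + γ g(Y)` subject to `Y ∈ s`. -/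
def IsSolution {m n : ℕ} (f g : Matrix (Fin m) (Fin n) ℂ → ℝ) (γ : ℝ)
    (s : Set (Matrix (Fin m) (Fin n) ℂ)) (Ys : Matrix (Fin m) (Fin n) ℂ) : Prop :=
  Ys ∈ s ∧ IsMinOn (fun Z => f Z + γ * g Z) s Ys

end ActuatorSelection

end

open ActuatorSelection

/-! Two facts about a sublevel set of f carry the theorem: it is compact, and the convexity gap of f
on it is an explicit nonnegative quadratic expression.

Let W = sY + tZ, H = Y - Z, let K = W X(W)⁻¹ be the gain at W, and put E = H - K X'(H). Completing
the square gives the gap as st times a weighted sum of tr(E* R E X⁻¹) over X = X(Y) and X = X(Z)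
(`smoothCost_convexity_defect`). If E = 0, the gain is constant along the line W + rH; that line
never leaves the domain, which forces X'(H) to be semidefinite of trace zero, so X'(H) = 0 and H = K
X'(H) = 0 (`eq_zero_of_eq_gain_mul`). Compactness makes this nondegeneracy uniform and yields the
modulus.

For compactness (`isCompact_sublevel`), f controls tr X and Y. At a limit point Y annihilates the
kernel of X, and the Lyapunov equation with V ≻ 0 leaves no such kernel vector. Smoothness of f on a
compact convex set then gives the Lipschitz gradient, and compactness gives a minimizer.

The Lipschitz bound holds only on the sublevel set, so `proximal_gradient_step` must show that a
step stays there: while the segment to the next iterate remains in the set the objective does not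
exceed its initial value, so f stays strictly below a and the segment can be continued. The descent
lemma, the three-point inequality and strong convexity then add up to the contraction. -/

/-! ### Proximal gradient steps in a real inner product space. -/

section ProximalGradient

open Set Filter Topology

variable {E : Type*} [NormedAddCommGroup E] [InnerProductSpace ℝ E]

/-- Convex combinations satisfy the parallelogram-type identity in an inner product space. -/
lemma norm_sq_segment (x y : E) (t : ℝ) :
    ‖x + t • (y - x)‖ ^ 2 = (1 - t) * ‖x‖ ^ 2 + t * ‖y‖ ^ 2 - t * (1 - t) * ‖y - x‖ ^ 2 := by
  have h1 := norm_add_sq_real x (t • (y - x))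
  have h2 := norm_sub_sq_real y x
  rw [inner_smul_right, inner_sub_right, real_inner_self_eq_norm_sq, norm_smul, mul_pow,
    Real.norm_eq_abs, sq_abs, real_inner_comm] at h1
  rw [h1, h2]
  ring

lemma ConvexOn.le_segment {s : Set E} {h : E → ℝ} (hc : ConvexOn ℝ s h) {x y : E}
    (hx : x ∈ s) (hy : y ∈ s) {t : ℝ} (h0 : 0 ≤ t) (h1 : t ≤ 1) :
    h (x + t • (y - x)) ≤ (1 - t) * h x + t * h y := by
  have := hc.2 hx hy (sub_nonneg.2 h1) h0 (by ring)
  have e : x + t • (y - x) = (1 - t) • x + t • y := by module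
  rw [e]
  simpa using this

lemma le_of_forall_small_mul_add_le {a b c : ℝ}
    (h : ∀ t : ℝ, 0 < t → t ≤ 1 → a + (1 - t) * c ≤ b) : a + c ≤ b := by
  have ht : Tendsto (fun t : ℝ => a + (1 - t) * c) (𝓝[>] 0) (𝓝 (a + (1 - 0) * c)) := by
    apply Tendsto.mono_left _ nhdsWithin_le_nhds
    exact (Continuous.tendsto (by fun_prop) 0)
  have := le_of_tendsto ht (b := b) (by
    filter_upwards [Ioc_mem_nhdsGT (zero_lt_one (α := ℝ))] with t ht using h t ht.1 ht.2)
  simpa using this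

/-- The three-point inequality for a minimizer of `h + ½‖· - W‖²`, with `h` convex. -/
lemma prox_three_point {h : E → ℝ} (hc : ConvexOn ℝ univ h) {W P : E}
    (hP : ∀ Z, h P + 1 / 2 * ‖P - W‖ ^ 2 ≤ h Z + 1 / 2 * ‖Z - W‖ ^ 2) (Z : E) :
    h P + 1 / 2 * ‖P - W‖ ^ 2 + 1 / 2 * ‖Z - P‖ ^ 2 ≤ h Z + 1 / 2 * ‖Z - W‖ ^ 2 := by
  -- Minimality of P is tested at the point P + t(Z - P). After division by t, the term ½‖Z - P‖²
  -- carries a factor 1 - t, which disappears as t → 0.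
  apply le_of_forall_small_mul_add_le
  intro t h0 h1
  have a1 := hP (P + t • (Z - P))
  have a2 := hc.le_segment (mem_univ P) (mem_univ Z) h0.le h1
  have a3 := norm_sq_segment (P - W) (Z - W) t
  have e : P - W + t • (Z - W - (P - W)) = P + t • (Z - P) - W := by module
  have e' : Z - W - (P - W) = Z - P := by abel
  rw [e, e'] at a3
  rw [a3] at a1
  refine le_of_mul_le_mul_left ?_ h0
  nlinarith

lemma prox_unique {h : E → ℝ} (hc : ConvexOn ℝ univ h) {W P P' : E}
    (hP : ∀ Z, h P + 1 / 2 * ‖P - W‖ ^ 2 ≤ h Z + 1 / 2 * ‖Z - W‖ ^ 2)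
    (hP' : ∀ Z, h P' + 1 / 2 * ‖P' - W‖ ^ 2 ≤ h Z + 1 / 2 * ‖Z - W‖ ^ 2) : P' = P := by
  have h1 := prox_three_point hc hP P'
  have h2 := hP' P
  have : ‖P' - P‖ ^ 2 ≤ 0 := by linarith
  have : ‖P' - P‖ = 0 := by nlinarith [norm_nonneg (P' - P)]
  exact sub_eq_zero.1 (norm_eq_zero.1 this)

lemma prox_exists [FiniteDimensional ℝ E] {h : E → ℝ} (hcont : Continuous h)
    (h0 : ∀ Z, 0 ≤ h Z) (W : E) :
    ∃ P, ∀ Z, h P + 1 / 2 * ‖P - W‖ ^ 2 ≤ h Z + 1 / 2 * ‖Z - W‖ ^ 2 := by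
  have : ProperSpace E := FiniteDimensional.proper ℝ E
  apply Continuous.exists_forall_le (f := fun Z => h Z + 1 / 2 * ‖Z - W‖ ^ 2)
  · fun_prop
  · refine tendsto_atTop_mono (f := fun Z => 1 / 2 * ‖Z - W‖ ^ 2) (fun Z => by linarith [h0 Z]) ?_
    refine Tendsto.const_mul_atTop (by norm_num) ?_
    refine (tendsto_pow_atTop two_ne_zero).comp ?_
    simpa only [dist_eq_norm] using tendsto_dist_right_cocompact_atTop W

/-- The first-order lower bound of a strongly convex function at a point of differentiability. -/
lemma StrongConvexOn.gradient_lower_bound {s : Set E} {f : E → ℝ} {μ : ℝ}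
    (hf : StrongConvexOn s μ f) {x y G : E} (hx : x ∈ s) (hy : y ∈ s)
    (hG : HasFDerivAt f (innerSL ℝ G) x) :
    f x + inner ℝ G (y - x) + μ / 2 * ‖y - x‖ ^ 2 ≤ f y := by
  have hline : HasDerivAt (fun t : ℝ => f (x + t • (y - x))) (inner ℝ G (y - x)) 0 := by
    have hl : HasDerivAt (fun t : ℝ => x + t • (y - x)) (y - x) 0 := by
      simpa using ((hasDerivAt_id (0 : ℝ)).smul_const (y - x)).const_add x
    have hG' : HasFDerivAt f (innerSL ℝ G) (x + (0 : ℝ) • (y - x)) := by simpa using hG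
    exact hG'.comp_hasDerivAt 0 hl
  have hs := hline.tendsto_slope_zero_right
  simp only [zero_add, zero_smul, add_zero] at hs
  have ht : Tendsto (fun t : ℝ => f y - f x - (1 - t) * (μ / 2 * ‖y - x‖ ^ 2)) (𝓝[>] 0)
      (𝓝 (f y - f x - (1 - 0) * (μ / 2 * ‖y - x‖ ^ 2))) :=
    (Continuous.tendsto (by fun_prop) 0).mono_left nhdsWithin_le_nhds
  have := le_of_tendsto_of_tendsto hs ht (by
    filter_upwards [Ioc_mem_nhdsGT (zero_lt_one (α := ℝ))] with t ht
    have h := hf.2 hx hy (sub_nonneg.2 ht.2) ht.1.le (by ring)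
    have e : x + t • (y - x) = (1 - t) • x + t • y := by module
    rw [← e, norm_sub_rev x y] at h
    simp only [smul_eq_mul] at h ⊢
    rw [inv_mul_le_iff₀ ht.1]
    nlinarith)
  linarith

/-- The descent lemma along a segment contained in a set where the gradient is Lipschitz. -/
lemma descent_lemma {D : Set E} {f : E → ℝ} {G : E → E} {L : ℝ}
    (hG : ∀ Y ∈ D, HasFDerivAt f (innerSL ℝ (G Y)) Y)
    (hL : ∀ Y ∈ D, ∀ Z ∈ D, ‖G Y - G Z‖ ≤ L * ‖Y - Z‖)
    {x y : E} (hseg : ∀ t ∈ Icc (0 : ℝ) 1, x + t • (y - x) ∈ D) :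
    f y ≤ f x + inner ℝ (G x) (y - x) + L / 2 * ‖y - x‖ ^ 2 := by
  have hx : x ∈ D := by simpa using hseg 0 (by simp)
  -- f along the segment minus its claimed quadratic majorant, up to the constant f x; the Lipschitz
  -- bound makes the derivative nonpositive.
  set φ : ℝ → ℝ := fun t => f (x + t • (y - x)) - (t * inner ℝ (G x) (y - x) +
    L / 2 * ‖y - x‖ ^ 2 * t ^ 2) with hφ
  have hder : ∀ t ∈ Icc (0 : ℝ) 1, HasDerivAt φ (inner ℝ (G (x + t • (y - x))) (y - x) -
      (inner ℝ (G x) (y - x) + L / 2 * ‖y - x‖ ^ 2 * (2 * t))) t := by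
    intro t ht
    have hl : HasDerivAt (fun t : ℝ => x + t • (y - x)) (y - x) t := by
      simpa using ((hasDerivAt_id t).smul_const (y - x)).const_add x
    have h1 := (hG _ (hseg t ht)).comp_hasDerivAt t hl
    have h2 : HasDerivAt (fun t : ℝ => t * inner ℝ (G x) (y - x) +
        L / 2 * ‖y - x‖ ^ 2 * t ^ 2) (inner ℝ (G x) (y - x) + L / 2 * ‖y - x‖ ^ 2 * (2 * t)) t := by
      refine (((hasDerivAt_id t).mul_const (inner ℝ (G x) (y - x))).add
        ((hasDerivAt_pow 2 t).const_mul (L / 2 * ‖y - x‖ ^ 2))).congr_deriv ?_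
      simp
    exact h1.sub h2
  have hanti : AntitoneOn φ (Icc 0 1) := by
    refine antitoneOn_of_deriv_nonpos (convex_Icc 0 1)
      (fun t ht => (hder t ht).continuousAt.continuousWithinAt)
      (fun t ht => (hder t (interior_subset ht)).differentiableAt.differentiableWithinAt) ?_
    intro t ht
    have ht' := interior_subset ht
    rw [(hder t ht').deriv]
    have h1 : inner ℝ (G (x + t • (y - x)) - G x) (y - x) ≤
        ‖G (x + t • (y - x)) - G x‖ * ‖y - x‖ := real_inner_le_norm _ _
    have h2 := hL _ (hseg t ht') x hx
    rw [add_sub_cancel_left, norm_smul, Real.norm_eq_abs, abs_of_nonneg ht'.1] at h2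
    have h3 := mul_le_mul_of_nonneg_right h2 (norm_nonneg (y - x))
    rw [inner_sub_left] at h1
    nlinarith
  have := hanti (left_mem_Icc.2 zero_le_one) (right_mem_Icc.2 zero_le_one) zero_le_one
  simp only [hφ, one_smul, add_sub_cancel, zero_smul, add_zero] at this
  linarith

/-- The proximal gradient step for `f + g` from a point of the sublevel set `D` of `f` where
`f + g < a`: the whole segment to the next iterate stays in `D`, the objective does not increase,
and the distance to any minimizer in `D` contracts. -/
theorem proximal_gradient_step {S : Set E} (hS : IsOpen S) {f g : E → ℝ} {G : E → E} {a μ L α : ℝ}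
    (hD : IsClosed {Y | Y ∈ S ∧ f Y ≤ a})
    (hG : ∀ Y ∈ {Y | Y ∈ S ∧ f Y ≤ a}, HasFDerivAt f (innerSL ℝ (G Y)) Y)
    (hL : ∀ Y ∈ {Y | Y ∈ S ∧ f Y ≤ a}, ∀ Z ∈ {Y | Y ∈ S ∧ f Y ≤ a},
      ‖G Y - G Z‖ ≤ L * ‖Y - Z‖)
    (hμ : StrongConvexOn {Y | Y ∈ S ∧ f Y ≤ a} μ f)
    (hg : ConvexOn ℝ univ g) (hg0 : ∀ Z, 0 ≤ g Z) (hα : 0 ≤ α) (hαL : α * L ≤ 1)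
    {Y P : E} (hY : Y ∈ S) (hYa : f Y + g Y < a)
    (hP : ∀ Z, α * g P + 1 / 2 * ‖P - (Y - α • G Y)‖ ^ 2 ≤
      α * g Z + 1 / 2 * ‖Z - (Y - α • G Y)‖ ^ 2) :
    P ∈ S ∧ f P + g P ≤ f Y + g Y ∧
      ∀ Ys ∈ {Y | Y ∈ S ∧ f Y ≤ a}, f Ys + g Ys ≤ f P + g P →
        ‖P - Ys‖ ^ 2 ≤ (1 - μ * α) * ‖Y - Ys‖ ^ 2 := by
  set D : Set E := {Y | Y ∈ S ∧ f Y ≤ a} with hDdef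
  have hYD : Y ∈ D := ⟨hY, by linarith [hg0 Y]⟩
  -- The three-point inequality with both squares expanded around Y; the common term ‖α G Y‖²
  -- cancels.
  have key : ∀ Z, α * g P + 1 / 2 * ‖P - Y‖ ^ 2 + α * inner ℝ (G Y) (P - Y) +
      1 / 2 * ‖Z - P‖ ^ 2 ≤ α * g Z + 1 / 2 * ‖Z - Y‖ ^ 2 + α * inner ℝ (G Y) (Z - Y) := by
    intro Z
    have h := prox_three_point (h := fun Z => α * g Z) (hg.smul hα) hP Z
    have e : ∀ Z : E, ‖Z - (Y - α • G Y)‖ ^ 2 = ‖Z - Y‖ ^ 2 + 2 * (α * inner ℝ (G Y) (Z - Y)) +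
        ‖α • G Y‖ ^ 2 := by
      intro Z
      rw [← sub_add, norm_add_sq_real, inner_smul_right, real_inner_comm]
    rw [e, e] at h
    linarith
  -- For α = 0 the step is the identity; the descent estimate below divides by α.
  rcases hα.eq_or_lt with rfl | hα0
  · have h := key Y
    simp only [zero_mul, zero_add, add_zero, sub_self, norm_zero] at h
    have : ‖P - Y‖ = 0 := by
      rw [norm_sub_rev Y P] at h
      nlinarith [norm_nonneg (P - Y)]
    obtain rfl : P = Y := sub_eq_zero.1 (norm_eq_zero.1 this)
    exact ⟨hY, le_rfl, fun Ys _ _ => by simp⟩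
  -- Descent at any point of the segment already known to lie in D. Convexity of D supplies the
  -- subsegment for the descent lemma, and αL ≤ 1 lets `key` at Z = Y absorb the quadratic term.
  have hdesc : ∀ t ∈ Icc (0 : ℝ) 1, Y + t • (P - Y) ∈ D →
      f (Y + t • (P - Y)) + g (Y + t • (P - Y)) ≤ f Y + g Y := by
    intro t ht htD
    have hseg : ∀ u ∈ Icc (0 : ℝ) 1, Y + u • (Y + t • (P - Y) - Y) ∈ D :=
      fun u hu => hμ.1.add_smul_sub_mem hYD htD hu
    have h1 := descent_lemma hG hL hseg
    rw [add_sub_cancel_left, inner_smul_right, norm_smul, Real.norm_eq_abs, mul_pow, sq_abs] at h1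
    have h2 := hg.le_segment (mem_univ Y) (mem_univ P) ht.1 ht.2
    have h3 := key Y
    simp only [sub_self, norm_zero, inner_zero_right] at h3
    rw [norm_sub_rev Y P] at h3
    refine le_of_mul_le_mul_left ?_ hα0
    have h4 : α * (f (Y + t • (P - Y)) + g (Y + t • (P - Y))) ≤ α * (f Y +
        t * inner ℝ (G Y) (P - Y) + L / 2 * (t ^ 2 * ‖P - Y‖ ^ 2) + ((1 - t) * g Y + t * g P)) :=
      mul_le_mul_of_nonneg_left (by linarith) hα
    have h5 : α * L * (t ^ 2 * ‖P - Y‖ ^ 2) ≤ 1 * (t ^ 2 * ‖P - Y‖ ^ 2) :=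
      mul_le_mul_of_nonneg_right hαL (by positivity)
    have h6 := mul_le_mul_of_nonneg_left h3 ht.1
    have h7 : t ^ 2 * ‖P - Y‖ ^ 2 ≤ t * ‖P - Y‖ ^ 2 :=
      mul_le_mul_of_nonneg_right (by nlinarith [ht.1, ht.2]) (by positivity)
    have h8 : 0 ≤ t * ‖P - Y‖ ^ 2 := mul_nonneg ht.1 (by positivity)
    nlinarith
  have hcont : Continuous fun t : ℝ => Y + t • (P - Y) := by fun_prop
  -- Continuation: the set of good parameters is closed, and at a good t < 1 descent gives f < a
  -- strictly, so continuity of f and openness of S allow a slightly larger parameter.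
  have hsub : Icc (0 : ℝ) 1 ⊆ {t | Y + t • (P - Y) ∈ D} := by
    refine IsClosed.Icc_subset_of_forall_exists_gt ((hD.preimage hcont).inter isClosed_Icc)
      (by simpa using hYD) ?_
    rintro t ⟨htD, ht0, ht1⟩ u (hu : t < u)
    have h1 : f (Y + t • (P - Y)) < a := by
      linarith [hdesc t ⟨ht0, ht1.le⟩ htD, hg0 (Y + t • (P - Y))]
    have h2 : ∀ᶠ r in 𝓝 t, Y + r • (P - Y) ∈ D := by
      have hc : ContinuousAt (fun r : ℝ => f (Y + r • (P - Y))) t :=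
        ContinuousAt.comp (f := fun r : ℝ => Y + r • (P - Y)) (g := f)
          (hG _ htD).continuousAt hcont.continuousAt
      filter_upwards [hcont.continuousAt.eventually (hS.mem_nhds htD.1),
        hc.eventually (gt_mem_nhds h1)] with r hr1 hr2 using ⟨hr1, le_of_lt hr2⟩
    obtain ⟨r, hr1, hr2⟩ :=
      ((h2.filter_mono nhdsWithin_le_nhds).and (Ioc_mem_nhdsGT hu)).exists
    exact ⟨r, hr1, hr2⟩
  have hseg : ∀ t ∈ Icc (0 : ℝ) 1, Y + t • (P - Y) ∈ D := hsub
  have hPD : P ∈ D := by simpa using hseg 1 (by simp)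
  refine ⟨hPD.1, by simpa using hdesc 1 (by simp) (by simpa using hPD), ?_⟩
  intro Ys hYs hle
  have h1 := descent_lemma hG hL hseg
  have h2 := key Ys
  have h3 := hμ.gradient_lower_bound hYD hYs (hG Y hYD)
  rw [norm_sub_rev Ys P, norm_sub_rev Ys Y] at h2
  rw [norm_sub_rev Ys Y] at h3
  have h5 : α * L * ‖P - Y‖ ^ 2 ≤ 1 * ‖P - Y‖ ^ 2 :=
    mul_le_mul_of_nonneg_right hαL (by positivity)
  have h6 := mul_le_mul_of_nonneg_left h1 hα
  have h7 := mul_le_mul_of_nonneg_left h3 hα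
  have h8 := mul_le_mul_of_nonneg_left hle hα
  nlinarith

end ProximalGradient

/-! ### Frobenius geometry and positive definite matrices. -/

section FrobeniusMatrix

variable {k l p : Type*} [Fintype k] [Fintype l] [Fintype p]

lemma frobenius_norm_sq_eq_re_trace (M : Matrix k l ℂ) : ‖M‖ ^ 2 = (Mᴴ * M).trace.re := by
  rw [Matrix.frobenius_norm_def, ← Real.sqrt_eq_rpow,
    Real.sq_sqrt (Finset.sum_nonneg fun i _ => Finset.sum_nonneg fun j _ => by positivity)]
  simp only [Matrix.trace, Matrix.diag, Matrix.mul_apply, Complex.re_sum,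
    Matrix.conjTranspose_apply]
  rw [Finset.sum_comm]
  refine Finset.sum_congr rfl fun i _ => Finset.sum_congr rfl fun j _ => ?_
  rw [Real.rpow_two, ← Complex.normSq_eq_norm_sq, Complex.normSq_apply]
  simp

lemma re_trace_conjTranspose (M : Matrix k k ℂ) : Mᴴ.trace.re = M.trace.re := by
  simp [Matrix.trace_conjTranspose]

/-- The real inner product `Re tr (M* N)` on complex matrices, which induces the Frobenius norm. -/
@[reducible]
noncomputable def frobeniusInnerProductSpace : InnerProductSpace ℝ (Matrix k l ℂ) where
  toNormedSpace := Matrix.frobeniusNormedSpace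
  inner M N := (Mᴴ * N).trace.re
  norm_sq_eq_re_inner M := frobenius_norm_sq_eq_re_trace M
  conj_inner_symm M N := by
    change (Nᴴ * M).trace.re = (Mᴴ * N).trace.re
    rw [← re_trace_conjTranspose]
    simp
  add_left M N P := by simp [Matrix.add_mul]
  smul_left M N r := by
    simp [Matrix.conjTranspose_smul]

open scoped MatrixOrder Matrix.Norms.L2Operator in
-- This factorization turns the traces below into squared Frobenius norms, to which
-- submultiplicativity applies.
lemma Matrix.PosSemidef.exists_conjTranspose_mul_self [DecidableEq k] {M : Matrix k k ℂ}
    (hM : M.PosSemidef) : ∃ C : Matrix k k ℂ, M = Cᴴ * C :=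
  CStarAlgebra.nonneg_iff_eq_star_mul_self.mp hM.nonneg

lemma Matrix.PosDef.exists_conjTranspose_mul_self [DecidableEq k] {M : Matrix k k ℂ}
    (hM : M.PosDef) : ∃ C : Matrix k k ℂ, IsUnit C ∧ M = Cᴴ * C := by
  obtain ⟨C, rfl⟩ := hM.posSemidef.exists_conjTranspose_mul_self
  have := hM.isUnit
  rw [Matrix.isUnit_iff_isUnit_det, Matrix.det_mul] at this
  exact ⟨C, (Matrix.isUnit_iff_isUnit_det C).2 (isUnit_of_mul_isUnit_right this), rfl⟩

omit [Fintype l] in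
lemma eq_zero_of_isUnit_mul [DecidableEq k] {C : Matrix k k ℂ} (hC : IsUnit C) {M : Matrix k l ℂ}
    (h : C * M = 0) : M = 0 := by
  have := (Matrix.isUnit_iff_isUnit_det C).1 hC
  rw [← Matrix.nonsing_inv_mul_cancel_left C M this, h, Matrix.mul_zero]

omit [Fintype l] in
lemma Matrix.PosDef.eq_zero_of_conjTranspose_mul_mul [DecidableEq k] {P : Matrix k k ℂ}
    (hP : P.PosDef) {M : Matrix k l ℂ} (h : Mᴴ * P * M = 0) : M = 0 := by
  obtain ⟨C, hC, rfl⟩ := hP.exists_conjTranspose_mul_self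
  refine eq_zero_of_isUnit_mul hC (Matrix.conjTranspose_mul_self_eq_zero.1 ?_)
  rw [Matrix.conjTranspose_mul, ← h]
  simp only [Matrix.mul_assoc]

lemma Matrix.PosSemidef.posDef_of_forall_mul_eq_zero [DecidableEq k] {X : Matrix k k ℂ}
    (hX : X.PosSemidef) (h : ∀ M : Matrix k k ℂ, X * M = 0 → M = 0) : X.PosDef := by
  rw [hX.posDef_iff_det_ne_zero]
  intro hdet
  obtain ⟨v, hv, hXv⟩ := Matrix.exists_mulVec_eq_zero_iff.2 hdet
  apply hv
  -- The kernel vector is repeated in every column, since the hypothesis tests square matrices.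
  have := h (Matrix.replicateCol k v) (by rw [← Matrix.replicateCol_mulVec, hXv]; rfl)
  ext i
  simpa using congrFun (congrFun this i) i

lemma isClosed_setOf_posSemidef : IsClosed {X : Matrix k k ℂ | X.PosSemidef} := by
  simp only [Matrix.posSemidef_iff_dotProduct_mulVec, Set.ofPred_and, Set.ofPred_forall]
  refine IsClosed.inter ?_ (isClosed_iInter fun x => ?_)
  · exact isClosed_eq (by fun_prop) continuous_id
  · exact isClosed_le continuous_const
      (continuous_const.dotProduct (continuous_id.matrix_mulVec continuous_const))

/-- Positivity of the quadratic form on the compact unit sphere persists uniformly for nearby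
matrices, and homogeneity extends it to all vectors. Continuity controls only the real part, hence
the Hermitian proviso. -/
lemma Matrix.PosDef.eventually_posDef_of_isHermitian {X : Matrix k k ℂ} (hX : X.PosDef) :
    ∀ᶠ Z in nhds X, Z.IsHermitian → Z.PosDef := by
  have hK : IsCompact (Metric.sphere (0 : EuclideanSpace ℂ k) 1) := isCompact_sphere _ _
  have := hK.eventually_forall_of_forall_eventually (x₀ := X)
    (P := fun Z v => 0 < (star (WithLp.ofLp v) ⬝ᵥ (Z *ᵥ WithLp.ofLp v)).re) (by
      intro v hv
      have hv0 : (WithLp.ofLp v) ≠ 0 := by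
        rintro h
        have : v = 0 := by ext i; simp [h]
        simp [this] at hv
      have hpos := hX.re_dotProduct_pos hv0
      have hc : Continuous fun z : Matrix k k ℂ × EuclideanSpace ℂ k =>
          (star (WithLp.ofLp z.2) ⬝ᵥ (z.1 *ᵥ WithLp.ofLp z.2)).re := by
        refine Complex.continuous_re.comp (Continuous.dotProduct ?_ ?_)
        · fun_prop
        · exact continuous_fst.matrix_mulVec (by fun_prop)
      exact hc.continuousAt.eventually (lt_mem_nhds hpos))
  filter_upwards [this] with Z hZ hH
  refine Matrix.PosDef.of_dotProduct_mulVec_pos hH fun x hx => ?_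
  have him : (star x ⬝ᵥ (Z *ᵥ x)).im = 0 := hH.im_star_dotProduct_mulVec_self x
  have hx' : (WithLp.toLp 2 x : EuclideanSpace ℂ k) ≠ 0 := by simpa using hx
  have h := hZ ((‖(WithLp.toLp 2 x : EuclideanSpace ℂ k)‖⁻¹ : ℝ) • WithLp.toLp 2 x) (by
    simp [norm_smul, hx])
  rw [Complex.pos_iff]
  refine ⟨?_, him.symm⟩
  simp only [WithLp.ofLp_smul, star_smul, Matrix.mulVec_smul, smul_dotProduct,
    dotProduct_smul] at h
  simp only [star_trivial, Complex.real_smul, Complex.re_ofReal_mul] at h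
  have hn : 0 < ‖(WithLp.toLp 2 x : EuclideanSpace ℂ k)‖⁻¹ := inv_pos.2 (norm_pos_iff.2 hx')
  exact pos_of_mul_pos_right (pos_of_mul_pos_right h hn.le) hn.le

/-! ### The matrix-fractional function -/

variable [DecidableEq k] [DecidableEq l]

/-- The matrix-fractional function `Re tr (Y* R Y X⁻¹)`. -/
noncomputable def matrixFractional (R : Matrix k k ℂ) (Y : Matrix k l ℂ) (X : Matrix l l ℂ) : ℝ :=
  (Yᴴ * R * Y * X⁻¹).trace.re

omit [DecidableEq k] in
lemma matrixFractional_conjTranspose_mul_self (F : Matrix k k ℂ) (Y : Matrix k l ℂ)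
    (C : Matrix l l ℂ) :
    matrixFractional (Fᴴ * F) Y (Cᴴ * C) = ‖F * Y * C⁻¹‖ ^ 2 := by
  rw [frobenius_norm_sq_eq_re_trace, matrixFractional, Matrix.mul_inv_rev,
    ← Matrix.mul_assoc, Matrix.trace_mul_comm]
  simp only [Matrix.conjTranspose_mul, Matrix.conjTranspose_nonsing_inv, Matrix.mul_assoc]

lemma matrixFractional_nonneg {R : Matrix k k ℂ} (hR : R.PosSemidef) (Y : Matrix k l ℂ)
    {X : Matrix l l ℂ} (hX : X.PosSemidef) : 0 ≤ matrixFractional R Y X := by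
  obtain ⟨F, rfl⟩ := hR.exists_conjTranspose_mul_self
  obtain ⟨C, rfl⟩ := hX.exists_conjTranspose_mul_self
  rw [matrixFractional_conjTranspose_mul_self]
  positivity

lemma matrixFractional_pos {R : Matrix k k ℂ} (hR : R.PosDef) {Y : Matrix k l ℂ}
    {X : Matrix l l ℂ} (hX : X.PosDef) (hY : Y ≠ 0) : 0 < matrixFractional R Y X := by
  refine (matrixFractional_nonneg hR.posSemidef Y hX.posSemidef).lt_of_ne' fun h => hY ?_
  obtain ⟨F, hF, rfl⟩ := hR.exists_conjTranspose_mul_self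
  obtain ⟨C, hC, rfl⟩ := hX.exists_conjTranspose_mul_self
  rw [matrixFractional_conjTranspose_mul_self] at h
  have h0 : F * Y * C⁻¹ = 0 := norm_eq_zero.1 (pow_eq_zero_iff two_ne_zero |>.1 h)
  have hC' := (Matrix.isUnit_iff_isUnit_det C).1 hC
  refine eq_zero_of_isUnit_mul hF ?_
  rw [← Matrix.nonsing_inv_mul_cancel_right C (F * Y) hC', h0, Matrix.zero_mul]

omit [DecidableEq k] in
lemma matrixFractional_smul (R : Matrix k k ℂ) (Y : Matrix k l ℂ) (X : Matrix l l ℂ) (r : ℝ) :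
    matrixFractional R (r • Y) X = r ^ 2 * matrixFractional R Y X := by
  simp only [matrixFractional, Matrix.conjTranspose_smul, star_trivial, Matrix.smul_mul,
    Matrix.mul_smul, Matrix.trace_smul, Complex.smul_re, smul_eq_mul]
  ring

omit [DecidableEq k] in
-- Completing the square: for fixed K the correction terms are linear in (Y, X), so replacing Y by
-- the residual Y - KX does not change the convexity gap.
lemma matrixFractional_sub_mul {R : Matrix k k ℂ} (hR : R.IsHermitian) (Y K : Matrix k l ℂ)
    {X : Matrix l l ℂ} (hX : X.PosDef) :
    matrixFractional R (Y - K * X) X = matrixFractional R Y X - 2 * (Kᴴ * R * Y).trace.re +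
      (Kᴴ * R * K * X).trace.re := by
  have hu := (Matrix.isUnit_iff_isUnit_det X).1 hX.isUnit
  have h1 : (Y - K * X)ᴴ * R * (Y - K * X) * X⁻¹ =
      Yᴴ * R * Y * X⁻¹ - Yᴴ * R * K - X * (Kᴴ * R * Y * X⁻¹) + X * (Kᴴ * R * K) := by
    rw [Matrix.conjTranspose_sub, Matrix.conjTranspose_mul, hX.isHermitian.eq]
    simp only [Matrix.sub_mul, Matrix.mul_sub, ← Matrix.mul_assoc]
    rw [Matrix.mul_nonsing_inv_cancel_right _ _ hu, Matrix.mul_nonsing_inv_cancel_right _ _ hu]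
    abel
  have h2 : (Yᴴ * R * K).trace.re = (Kᴴ * R * Y).trace.re := by
    rw [← re_trace_conjTranspose]
    simp [Matrix.conjTranspose_mul, hR.eq, Matrix.mul_assoc]
  have h3 : (X * (Kᴴ * R * Y * X⁻¹)).trace = (Kᴴ * R * Y).trace := by
    rw [Matrix.trace_mul_comm, Matrix.nonsing_inv_mul_cancel_right _ _ hu]
  rw [matrixFractional, h1, Matrix.trace_add, Matrix.trace_sub, Matrix.trace_sub, h3,
    Matrix.trace_mul_comm X, Complex.add_re, Complex.sub_re, Complex.sub_re, h2, matrixFractional]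
  ring

omit [DecidableEq k] in
/-- The exact convexity defect of the matrix-fractional function. -/
lemma matrixFractional_convexity_defect {R : Matrix k k ℂ} (hR : R.IsHermitian)
    {Y₁ Y₂ : Matrix k l ℂ} {X₁ X₂ : Matrix l l ℂ} (hX₁ : X₁.PosDef) (hX₂ : X₂.PosDef)
    {s t : ℝ} (hst : s + t = 1) (hX : (s • X₁ + t • X₂).PosDef) {K : Matrix k l ℂ}
    (hK : K = (s • Y₁ + t • Y₂) * (s • X₁ + t • X₂)⁻¹) :
    s * matrixFractional R Y₁ X₁ + t * matrixFractional R Y₂ X₂ =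
      matrixFractional R (s • Y₁ + t • Y₂) (s • X₁ + t • X₂) +
      s * t * (t * matrixFractional R (Y₁ - Y₂ - K * (X₁ - X₂)) X₁ +
        s * matrixFractional R (Y₁ - Y₂ - K * (X₁ - X₂)) X₂) := by
  have hu := (Matrix.isUnit_iff_isUnit_det _).1 hX.isUnit
  have hKX : K * (s • X₁ + t • X₂) = s • Y₁ + t • Y₂ := by
    rw [hK, Matrix.nonsing_inv_mul_cancel_right _ _ hu]
  -- K is the gain of the convex combination, whose residual therefore vanishes; the residuals at
  -- the two ends are then multiples t and -s of one matrix.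
  have e1 : Y₁ - K * X₁ = t • (Y₁ - Y₂ - K * (X₁ - X₂)) := by
    have h : Y₁ - K * X₁ = (Y₁ - K * X₁) - ((s • Y₁ + t • Y₂) - K * (s • X₁ + t • X₂)) := by
      rw [hKX]; simp
    rw [h, Matrix.mul_add, Matrix.mul_sub, Matrix.mul_smul, Matrix.mul_smul]
    obtain rfl : s = 1 - t := by linarith
    module
  have e2 : Y₂ - K * X₂ = (-s) • (Y₁ - Y₂ - K * (X₁ - X₂)) := by
    have h : Y₂ - K * X₂ = (Y₂ - K * X₂) - ((s • Y₁ + t • Y₂) - K * (s • X₁ + t • X₂)) := by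
      rw [hKX]; simp
    rw [h, Matrix.mul_add, Matrix.mul_sub, Matrix.mul_smul, Matrix.mul_smul]
    obtain rfl : t = 1 - s := by linarith
    module
  have h1 := matrixFractional_sub_mul hR Y₁ K hX₁
  have h2 := matrixFractional_sub_mul hR Y₂ K hX₂
  have h3 := matrixFractional_sub_mul hR (s • Y₁ + t • Y₂) K hX
  have h0 : matrixFractional R (0 : Matrix k l ℂ) (s • X₁ + t • X₂) = 0 := by
    simp [matrixFractional]
  rw [e1, matrixFractional_smul] at h1
  rw [e2, matrixFractional_smul] at h2
  rw [hKX, sub_self, h0] at h3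
  simp only [Matrix.mul_add, Matrix.mul_smul, Matrix.trace_add, Matrix.trace_smul, Complex.add_re,
    Complex.smul_re, smul_eq_mul] at h3
  obtain rfl : s = 1 - t := by linarith
  linear_combination h3 + (-t) * h2 - (1 - t) * h1

omit [DecidableEq k] in
-- With X = C*C, factor FYM = (FYC⁻¹)(CM). Once the fractional term is replaced by an upper bound,
-- no inverse of X remains, so the estimate survives limits in which X could become singular.
lemma norm_mul_mul_sq_le_matrixFractional (F : Matrix k k ℂ) (Y : Matrix k l ℂ)
    {X : Matrix l l ℂ} (hX : X.PosDef) (M : Matrix l p ℂ) :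
    ‖F * Y * M‖ ^ 2 ≤ matrixFractional (Fᴴ * F) Y X * (Mᴴ * X * M).trace.re := by
  obtain ⟨C, hC, rfl⟩ := hX.exists_conjTranspose_mul_self
  have hC' := (Matrix.isUnit_iff_isUnit_det C).1 hC
  have e : (Mᴴ * (Cᴴ * C) * M).trace.re = ‖C * M‖ ^ 2 := by
    rw [frobenius_norm_sq_eq_re_trace, Matrix.conjTranspose_mul]
    simp only [Matrix.mul_assoc]
  rw [matrixFractional_conjTranspose_mul_self, e, ← mul_pow]
  refine pow_le_pow_left₀ (norm_nonneg _) ?_ 2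
  have : F * Y * M = F * Y * C⁻¹ * (C * M) := by
    rw [← Matrix.mul_assoc, Matrix.nonsing_inv_mul_cancel_right _ _ hC']
  rw [this]
  exact Matrix.frobenius_norm_mul _ _

/-- For `Q ≻ 0`, the trace of `X ⪰ 0` is controlled by `tr (Q X)`. -/
lemma Matrix.PosDef.exists_trace_le {Q : Matrix l l ℂ} (hQ : Q.PosDef) :
    ∃ c : ℝ, 0 ≤ c ∧ ∀ X : Matrix l l ℂ, X.PosSemidef →
      0 ≤ (Q * X).trace.re ∧ X.trace.re ≤ c * (Q * X).trace.re := by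
  obtain ⟨D, hD, rfl⟩ := hQ.exists_conjTranspose_mul_self
  have hD' := (Matrix.isUnit_iff_isUnit_det D).1 hD
  -- With Q = D*D and X = C*C, the two traces are ‖DC*‖² and ‖C‖².
  refine ⟨‖D⁻¹‖ ^ 2, by positivity, fun X hX => ?_⟩
  obtain ⟨C, rfl⟩ := hX.exists_conjTranspose_mul_self
  have e : (Dᴴ * D * (Cᴴ * C)).trace.re = ‖D * Cᴴ‖ ^ 2 := by
    rw [frobenius_norm_sq_eq_re_trace, Matrix.trace_mul_comm, Matrix.trace_mul_comm,
      ← Matrix.mul_assoc, Matrix.trace_mul_comm]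
    simp only [Matrix.conjTranspose_mul, Matrix.conjTranspose_conjTranspose, Matrix.mul_assoc]
  rw [e, ← frobenius_norm_sq_eq_re_trace, ← mul_pow]
  refine ⟨by positivity, pow_le_pow_left₀ (norm_nonneg _) ?_ 2⟩
  rw [← Matrix.frobenius_norm_conjTranspose C]
  calc ‖Cᴴ‖ = ‖D⁻¹ * (D * Cᴴ)‖ := by rw [Matrix.nonsing_inv_mul_cancel_left _ _ hD']
    _ ≤ _ := Matrix.frobenius_norm_mul _ _

end FrobeniusMatrix

/-! ### The Lyapunov equation and the actuator-selection cost. -/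

section ActuatorProblem

open Set Filter Topology

variable {m n : ℕ} {A : Matrix (Fin n) (Fin n) ℂ} {B : Matrix (Fin n) (Fin m) ℂ}
  {V Q : Matrix (Fin n) (Fin n) ℂ} {R : Matrix (Fin m) (Fin m) ℂ}

lemma lyapOp_apply (A X : Matrix (Fin n) (Fin n) ℂ) : lyapOp A X = A * X + X * Aᴴ := rfl

lemma lyapOp_inverse_apply (hA : IsUnit (lyapOp A)) (M : Matrix (Fin n) (Fin n) ℂ) :
    lyapOp A (Ring.inverse (lyapOp A) M) = M := by
  rw [← Module.End.mul_apply, Ring.mul_inverse_cancel _ hA, Module.End.one_apply]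

lemma lyapOp_injective (hA : IsUnit (lyapOp A)) : Function.Injective (lyapOp A) :=
  ((Module.End.isUnit_iff _).1 hA).1

/-- The Lyapunov operator commutes with conjugate transposition, so injectivity transfers the
symmetry. -/
lemma isHermitian_inverse_lyapOp (hA : IsUnit (lyapOp A)) {M : Matrix (Fin n) (Fin n) ℂ}
    (hM : M.IsHermitian) : (Ring.inverse (lyapOp A) M).IsHermitian := by
  apply lyapOp_injective hA
  have h : ∀ X, lyapOp A Xᴴ = (lyapOp A X)ᴴ := fun X => by
    simp [lyapOp_apply, add_comm]
  rw [h, lyapOp_inverse_apply hA, hM.eq]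

lemma isHermitian_inputOp (B : Matrix (Fin n) (Fin m) ℂ) (Y : Matrix (Fin m) (Fin n) ℂ) :
    (inputOp B Y).IsHermitian := by
  simp [Matrix.IsHermitian, inputOp, add_comm]

/-- The linear part of the affine map `Y ↦ X(Y)`. -/
noncomputable def stateCovDir (A : Matrix (Fin n) (Fin n) ℂ) (B : Matrix (Fin n) (Fin m) ℂ) :
    Matrix (Fin m) (Fin n) ℂ →ₗ[ℝ] Matrix (Fin n) (Fin n) ℂ where
  toFun H := Ring.inverse (lyapOp A) (inputOp B H)
  map_add' H H' := by
    rw [← map_add]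
    congr 1
    simp only [inputOp, Matrix.mul_add, Matrix.conjTranspose_add, Matrix.add_mul]
    abel
  map_smul' r H := by
    rw [RingHom.id_apply, ← LinearMap.map_smul_of_tower]
    congr 1
    simp [inputOp, Matrix.conjTranspose_smul]

lemma stateCov_eq (Y : Matrix (Fin m) (Fin n) ℂ) :
    stateCov A B V Y = stateCovDir A B Y - Ring.inverse (lyapOp A) V := by
  simp [stateCov, stateCovDir]

lemma stateCov_add (Y H : Matrix (Fin m) (Fin n) ℂ) :
    stateCov A B V (Y + H) = stateCov A B V Y + stateCovDir A B H := by
  rw [stateCov_eq, stateCov_eq, map_add]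
  abel

lemma stateCov_sub_stateCov (Y Z : Matrix (Fin m) (Fin n) ℂ) :
    stateCov A B V Y - stateCov A B V Z = stateCovDir A B (Y - Z) := by
  rw [stateCov_eq, stateCov_eq, map_sub]
  abel

lemma stateCov_convexComb (Y Z : Matrix (Fin m) (Fin n) ℂ) {s t : ℝ} (hst : s + t = 1) :
    stateCov A B V (s • Y + t • Z) = s • stateCov A B V Y + t • stateCov A B V Z := by
  rw [stateCov_eq, stateCov_eq, stateCov_eq, map_add, map_smul, map_smul]
  obtain rfl : s = 1 - t := by linarith
  module

lemma lyapOp_stateCov (hA : IsUnit (lyapOp A)) (Y : Matrix (Fin m) (Fin n) ℂ) :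
    lyapOp A (stateCov A B V Y) = inputOp B Y - V := lyapOp_inverse_apply hA _

lemma isHermitian_stateCov (hA : IsUnit (lyapOp A)) (hV : V.IsHermitian)
    (Y : Matrix (Fin m) (Fin n) ℂ) : (stateCov A B V Y).IsHermitian :=
  isHermitian_inverse_lyapOp hA ((isHermitian_inputOp B Y).sub hV)

lemma mem_stabDomain_iff (hA : IsUnit (lyapOp A)) {Y : Matrix (Fin m) (Fin n) ℂ} :
    Y ∈ stabDomain A B V ↔ (stateCov A B V Y).PosDef := by
  refine ⟨fun h => h.2, fun h => ⟨?_, h⟩⟩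
  rw [lyapOp_stateCov hA]
  abel

lemma contDiff_stateCov : ContDiff ℝ ⊤ (stateCov A B V) := by
  have : stateCov A B V = fun Y => (stateCovDir A B).toContinuousLinearMap Y -
      Ring.inverse (lyapOp A) V := by
    ext1 Y
    exact stateCov_eq Y
  rw [this]
  exact (ContinuousLinearMap.contDiff _).sub contDiff_const

lemma continuous_stateCov : Continuous (stateCov A B V) := contDiff_stateCov.continuous

lemma isOpen_stabDomain (hA : IsUnit (lyapOp A)) (hV : V.IsHermitian) :
    IsOpen (stabDomain A B V) := by
  rw [isOpen_iff_mem_nhds]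
  intro Y hY
  filter_upwards [continuous_stateCov.continuousAt.eventually
    ((mem_stabDomain_iff hA).1 hY).eventually_posDef_of_isHermitian] with Z hZ
  exact (mem_stabDomain_iff hA).2 (hZ (isHermitian_stateCov hA hV Z))

/-- If `X(Y)` and `Y` have a common kernel vector, the Lyapunov equation forces it to vanish. -/
lemma eq_zero_of_stateCov_mul_eq_zero (hA : IsUnit (lyapOp A)) (hV : V.PosDef)
    {Y : Matrix (Fin m) (Fin n) ℂ} {M : Matrix (Fin n) (Fin n) ℂ}
    (hX : stateCov A B V Y * M = 0) (hY : Y * M = 0) : M = 0 := by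
  have hX' : Mᴴ * stateCov A B V Y = 0 := by
    rw [← (isHermitian_stateCov hA hV.isHermitian Y).eq, ← Matrix.conjTranspose_mul, hX,
      Matrix.conjTranspose_zero]
  have hY' : Mᴴ * Yᴴ = 0 := by
    rw [← Matrix.conjTranspose_mul, hY, Matrix.conjTranspose_zero]
  apply hV.eq_zero_of_conjTranspose_mul_mul
  have e : V = inputOp B Y - lyapOp A (stateCov A B V Y) := by
    rw [lyapOp_stateCov hA]
    abel
  rw [e, lyapOp_apply, inputOp]
  simp only [Matrix.mul_sub, Matrix.sub_mul, Matrix.mul_add, Matrix.add_mul]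
  have t1 : Mᴴ * (B * Y) * M = 0 := by simp [Matrix.mul_assoc, hY]
  have t2 : Mᴴ * (Yᴴ * Bᴴ) * M = 0 := by rw [← Matrix.mul_assoc Mᴴ, hY']; simp
  have t3 : Mᴴ * (A * stateCov A B V Y) * M = 0 := by simp [Matrix.mul_assoc, hX]
  have t4 : Mᴴ * (stateCov A B V Y * Aᴴ) * M = 0 := by rw [← Matrix.mul_assoc Mᴴ, hX']; simp
  rw [t1, t2, t3, t4]
  simp

/-- A direction `H = K X'(H)` along which the feedback gain `K = Y X(Y)⁻¹` does not change is
zero. -/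
lemma eq_zero_of_eq_gain_mul (hA : IsUnit (lyapOp A)) (hV : V.PosDef)
    {Y H : Matrix (Fin m) (Fin n) ℂ} (hY : Y ∈ stabDomain A B V)
    (hH : H = Y * (stateCov A B V Y)⁻¹ * stateCovDir A B H) : H = 0 := by
  have hX := (mem_stabDomain_iff hA).1 hY
  have hu := (Matrix.isUnit_iff_isUnit_det _).1 hX.isUnit
  set Z := stateCovDir A B H with hZ
  have hXt : ∀ t : ℝ, stateCov A B V (Y + t • H) = stateCov A B V Y + t • Z := fun t => by
    rw [stateCov_add, map_smul]
  have hYt : ∀ t : ℝ, Y + t • H = Y * (stateCov A B V Y)⁻¹ * stateCov A B V (Y + t • H) := by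
    intro t
    rw [hXt, Matrix.mul_add, Matrix.nonsing_inv_mul_cancel_right _ _ hu, Matrix.mul_smul, ← hH]
  have hcont : Continuous fun t : ℝ => Y + t • H := by fun_prop
  -- Along this line Y + tH = K X, so every kernel vector of X is one of Y + tH, and the Lyapunov
  -- equation excludes it. Semidefiniteness thus already gives membership, and the set of parameters
  -- is closed as well as open.
  have hset : {t : ℝ | Y + t • H ∈ stabDomain A B V} =
      {t : ℝ | (stateCov A B V (Y + t • H)).PosSemidef} := by
    ext t
    simp only [mem_ofPred_eq, mem_stabDomain_iff hA]
    refine ⟨fun h => h.posSemidef, fun h => h.posDef_of_forall_mul_eq_zero fun M hM => ?_⟩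
    refine eq_zero_of_stateCov_mul_eq_zero hA hV hM ?_
    rw [hYt, Matrix.mul_assoc, hM, Matrix.mul_zero]
  have hclopen : IsClopen {t : ℝ | Y + t • H ∈ stabDomain A B V} := by
    refine ⟨?_, (isOpen_stabDomain hA hV.isHermitian).preimage hcont⟩
    rw [hset]
    exact isClosed_setOf_posSemidef.preimage (continuous_stateCov.comp hcont)
  have huniv := hclopen.eq_univ ⟨0, by simpa using hY⟩
  rw [hset] at huniv
  have hpsd : ∀ t : ℝ, (stateCov A B V Y + t • Z).PosSemidef := fun t => by
    rw [← hXt]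
    exact eq_univ_iff_forall.1 huniv t
  -- Z is the limit of (X + tZ)/t as t → ∞, written with s = 1/t.
  have hZpsd : Z.PosSemidef := by
    have hlim : Tendsto (fun s : ℝ => s • stateCov A B V Y + Z) (𝓝[>] 0)
        (𝓝 ((0 : ℝ) • stateCov A B V Y + Z)) :=
      (Continuous.tendsto (by fun_prop) 0).mono_left nhdsWithin_le_nhds
    rw [zero_smul, zero_add] at hlim
    refine isClosed_setOf_posSemidef.mem_of_tendsto hlim ?_
    filter_upwards [self_mem_nhdsWithin] with s (hs : 0 < s)
    have h := (hpsd s⁻¹).smul hs.le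
    rwa [smul_add, smul_smul, mul_inv_cancel₀ hs.ne', one_smul] at h
  have htr : ∀ t : ℝ, 0 ≤ (stateCov A B V Y).trace.re + t * Z.trace.re := fun t => by
    have := (Complex.le_def.1 (hpsd t).trace_nonneg).1
    simpa [Matrix.trace_add, Matrix.trace_smul] using this
  have htr0 : Z.trace.re = 0 := by
    by_contra hne
    -- At this parameter the affine function, nonnegative on all of ℝ, would equal -1.
    have h := htr (-((stateCov A B V Y).trace.re + 1) / Z.trace.re)
    rw [div_mul_cancel₀ _ hne] at h
    linarith
  have hZ0 : Z = 0 := by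
    rw [← hZpsd.trace_eq_zero_iff]
    have := (Complex.le_def.1 hZpsd.trace_nonneg).2
    exact Complex.ext htr0 this.symm
  rw [hH, hZ0, Matrix.mul_zero]

/-! ### The smooth part -/

lemma smoothCost_eq (Y : Matrix (Fin m) (Fin n) ℂ) :
    smoothCost A B V Q R Y = (Q * stateCov A B V Y).trace.re +
      matrixFractional R Y (stateCov A B V Y) := by
  simp [smoothCost, matrixFractional, Matrix.trace_add]

lemma convex_stabDomain (hA : IsUnit (lyapOp A)) : Convex ℝ (stabDomain A B V) := by
  intro Y hY Z hZ s t hs ht hst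
  rw [mem_stabDomain_iff hA] at *
  rw [stateCov_convexComb Y Z hst]
  rcases hs.eq_or_lt with rfl | hs
  · obtain rfl : t = 1 := by linarith
    simpa using hZ
  · exact (hY.smul hs).add_posSemidef (hZ.posSemidef.smul ht)

/-- The exact convexity defect of the smooth cost. -/
lemma smoothCost_convexity_defect (hA : IsUnit (lyapOp A)) (hR : R.IsHermitian)
    {Y Z : Matrix (Fin m) (Fin n) ℂ} (hY : Y ∈ stabDomain A B V) (hZ : Z ∈ stabDomain A B V)
    {s t : ℝ} (hs : 0 ≤ s) (ht : 0 ≤ t) (hst : s + t = 1)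
    {E : Matrix (Fin m) (Fin n) ℂ} (hE : E = Y - Z - (s • Y + t • Z) *
      (stateCov A B V (s • Y + t • Z))⁻¹ * stateCovDir A B (Y - Z)) :
    s * smoothCost A B V Q R Y + t * smoothCost A B V Q R Z =
      smoothCost A B V Q R (s • Y + t • Z) +
        s * t * (t * matrixFractional R E (stateCov A B V Y) +
          s * matrixFractional R E (stateCov A B V Z)) := by
  have hW := convex_stabDomain hA hY hZ hs ht hst
  rw [mem_stabDomain_iff hA] at hY hZ hW
  rw [stateCov_convexComb Y Z hst] at hW hE
  have h := matrixFractional_convexity_defect hR hY hZ hst hW (Y₁ := Y) (Y₂ := Z) rfl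
  rw [stateCov_sub_stateCov, ← hE] at h
  simp only [smoothCost_eq, stateCov_convexComb Y Z hst, Matrix.mul_add, Matrix.mul_smul,
    Matrix.trace_add, Matrix.trace_smul, Complex.add_re, Complex.smul_re, smul_eq_mul]
  linear_combination h

lemma convex_sublevel (hA : IsUnit (lyapOp A)) (hR : R.PosDef) (a : ℝ) :
    Convex ℝ (sublevel A B V Q R a) := by
  intro Y hY Z hZ s t hs ht hst
  refine ⟨convex_stabDomain hA hY.1 hZ.1 hs ht hst, ?_⟩
  have h := smoothCost_convexity_defect (Q := Q) hA hR.isHermitian hY.1 hZ.1 hs ht hst rfl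
  have h1 := mul_le_mul_of_nonneg_left hY.2 hs
  have h2 := mul_le_mul_of_nonneg_left hZ.2 ht
  set E := Y - Z - (s • Y + t • Z) *
      (stateCov A B V (s • Y + t • Z))⁻¹ * stateCovDir A B (Y - Z)
  have h3 := matrixFractional_nonneg hR.posSemidef E hY.1.2.posSemidef
  have h4 := matrixFractional_nonneg hR.posSemidef E hZ.1.2.posSemidef
  have h5 : 0 ≤ s * t * (t * matrixFractional R E (stateCov A B V Y) +
      s * matrixFractional R E (stateCov A B V Z)) := by positivity
  have h6 : s * a + t * a = a := by rw [← add_mul, hst, one_mul]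
  linarith

lemma ContDiffAt.matrix_mul {E : Type*} [NormedAddCommGroup E] [NormedSpace ℝ E]
    {k l p : Type*} [Fintype k] [Fintype l] [Fintype p] {N : WithTop ℕ∞}
    {f : E → Matrix k l ℂ} {g : E → Matrix l p ℂ} {x : E} (hf : ContDiffAt ℝ N f x)
    (hg : ContDiffAt ℝ N g x) : ContDiffAt ℝ N (fun y => f y * g y) x := by
  have hb : IsBoundedBilinearMap ℝ (fun q : Matrix k l ℂ × Matrix l p ℂ => q.1 * q.2) :=
    ⟨fun _ _ _ => Matrix.add_mul _ _ _, fun _ _ _ => Matrix.smul_mul _ _ _,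
      fun _ _ _ => Matrix.mul_add _ _ _, fun _ _ _ => Matrix.mul_smul _ _ _, 1, one_pos,
      fun x y => by simpa using Matrix.frobenius_norm_mul x y⟩
  exact hb.contDiff.contDiffAt.comp x (hf.prodMk hg)

lemma contDiff_conjTranspose {k l : Type*} [Fintype k] [Fintype l] {N : WithTop ℕ∞} :
    ContDiff ℝ N (fun M : Matrix k l ℂ => Mᴴ) :=
  (ContinuousLinearMap.contDiff
    (Matrix.conjTransposeLinearEquiv k l ℝ ℂ).toLinearMap.toContinuousLinearMap :)

section
attribute [local instance] Matrix.frobeniusNormedRing Matrix.frobeniusNormedAlgebra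

lemma contDiffAt_matrix_inv {k : Type*} [Fintype k] [DecidableEq k] {N : WithTop ℕ∞}
    {X : Matrix k k ℂ} (hX : IsUnit X) : ContDiffAt ℝ N (fun X : Matrix k k ℂ => X⁻¹) X := by
  obtain ⟨u, rfl⟩ := hX
  simpa [Matrix.nonsing_inv_eq_ringInverse] using contDiffAt_ringInverse (n := N) ℝ u
end

lemma contDiff_re_trace {k : Type*} [Fintype k] {N : WithTop ℕ∞} :
    ContDiff ℝ N (fun M : Matrix k k ℂ => M.trace.re) :=
  (ContinuousLinearMap.contDiff
    (Complex.reLm ∘ₗ Matrix.traceLinearMap k ℝ ℂ).toContinuousLinearMap :)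

lemma contDiffAt_matrixFractional {E : Type*} [NormedAddCommGroup E] [NormedSpace ℝ E]
    {k l : Type*} [Fintype k] [Fintype l] [DecidableEq l] {N : WithTop ℕ∞} (R : Matrix k k ℂ)
    {f : E → Matrix k l ℂ} {g : E → Matrix l l ℂ} {x : E} (hf : ContDiffAt ℝ N f x)
    (hg : ContDiffAt ℝ N g x) (hx : IsUnit (g x)) :
    ContDiffAt ℝ N (fun y => matrixFractional R (f y) (g y)) x :=
  contDiff_re_trace.contDiffAt.comp x
    ((((contDiff_conjTranspose.contDiffAt.comp x hf).matrix_mul contDiffAt_const).matrix_mul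
      hf).matrix_mul ((contDiffAt_matrix_inv hx).comp x hg))

lemma contDiffAt_smoothCost (hA : IsUnit (lyapOp A)) {Y : Matrix (Fin m) (Fin n) ℂ}
    (hY : Y ∈ stabDomain A B V) : ContDiffAt ℝ ⊤ (smoothCost A B V Q R) Y := by
  have h : smoothCost A B V Q R = fun Y => (Q * stateCov A B V Y).trace.re +
      matrixFractional R Y (stateCov A B V Y) := funext smoothCost_eq
  rw [h]
  have hX : ContDiffAt ℝ ⊤ (stateCov A B V) Y := contDiff_stateCov.contDiffAt
  exact (contDiff_re_trace.contDiffAt.comp Y (contDiffAt_const.matrix_mul hX)).add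
    (contDiffAt_matrixFractional R contDiffAt_id hX ((mem_stabDomain_iff hA).1 hY).isUnit)

/-- The delicate point is closedness, because f is continuous only where X(Y) is definite. The
closed set `T` contains the sublevel set and still lies inside the domain. -/
lemma isCompact_sublevel (hA : IsUnit (lyapOp A)) (hV : V.PosDef) (hQ : Q.PosDef)
    (hR : R.PosDef) (a : ℝ) : IsCompact (sublevel A B V Q R a) := by
  obtain ⟨F, hF, rfl⟩ := hR.exists_conjTranspose_mul_self
  obtain ⟨c, hc, htr⟩ := hQ.exists_trace_le
  have hF' := (Matrix.isUnit_iff_isUnit_det F).1 hF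
  set T : Set (Matrix (Fin m) (Fin n) ℂ) := {Y | (stateCov A B V Y).PosSemidef ∧
    ∀ M : Matrix (Fin n) (Fin n) ℂ, ‖F * Y * M‖ ^ 2 ≤
      a * (Mᴴ * stateCov A B V Y * M).trace.re} with hT
  have hTclosed : IsClosed T := by
    simp only [hT, Set.ofPred_and, Set.ofPred_forall]
    refine (isClosed_setOf_posSemidef.preimage continuous_stateCov).inter
      (isClosed_iInter fun M => isClosed_le ?_ ?_)
    · have h : Continuous fun Y : Matrix (Fin m) (Fin n) ℂ => F * Y * M := by fun_prop
      exact h.norm.pow 2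
    · have h : Continuous fun Y : Matrix (Fin m) (Fin n) ℂ => Mᴴ * stateCov A B V Y * M :=
        (continuous_const.matrix_mul continuous_stateCov).matrix_mul continuous_const
      exact continuous_const.mul (Complex.continuous_re.comp h.matrix_trace)
  have hTstab : T ⊆ stabDomain A B V := by
    rintro Y ⟨hX, hM⟩
    rw [mem_stabDomain_iff hA]
    -- If XM = 0, the inequality defining `T` gives FYM = 0, hence YM = 0, and the Lyapunov equation
    -- applies.
    refine hX.posDef_of_forall_mul_eq_zero fun M hXM => ?_
    refine eq_zero_of_stateCov_mul_eq_zero hA hV hXM (eq_zero_of_isUnit_mul hF ?_)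
    have h := hM M
    rw [Matrix.mul_assoc Mᴴ, hXM, Matrix.mul_zero, Matrix.trace_zero, Complex.zero_re,
      mul_zero] at h
    rw [← Matrix.mul_assoc]
    exact norm_eq_zero.1 (pow_eq_zero_iff two_ne_zero |>.1 (le_antisymm h (by positivity)))
  have hle : ∀ Y ∈ sublevel A B V Q (Fᴴ * F) a, (Q * stateCov A B V Y).trace.re ≤ a ∧
      matrixFractional (Fᴴ * F) Y (stateCov A B V Y) ≤ a := by
    rintro Y ⟨hY, hYa⟩
    rw [smoothCost_eq] at hYa
    have h1 := (htr _ hY.2.posSemidef).1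
    have h2 := matrixFractional_nonneg hR.posSemidef Y hY.2.posSemidef
    constructor <;> linarith
  have hsubT : sublevel A B V Q (Fᴴ * F) a ⊆ T := by
    intro Y hY
    refine ⟨hY.1.2.posSemidef, fun M => ?_⟩
    refine (norm_mul_mul_sq_le_matrixFractional F Y hY.1.2 M).trans ?_
    refine mul_le_mul_of_nonneg_right (hle Y hY).2 ?_
    exact (Complex.le_def.1 (hY.1.2.posSemidef.conjTranspose_mul_mul_same M).trace_nonneg).1
  have heq : sublevel A B V Q (Fᴴ * F) a = T ∩ smoothCost A B V Q (Fᴴ * F) ⁻¹' Iic a := by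
    ext Y
    exact ⟨fun h => ⟨hsubT h, h.2⟩, fun h => ⟨hTstab h.1, h.2⟩⟩
  have hclosed : IsClosed (sublevel A B V Q (Fᴴ * F) a) := by
    rw [heq]
    refine ContinuousOn.preimage_isClosed_of_isClosed (fun Y hY => ?_) hTclosed isClosed_Iic
    exact (contDiffAt_smoothCost hA (hTstab hY)).continuousAt.continuousWithinAt
  refine Metric.isCompact_of_isClosed_isBounded hclosed ?_
  rw [isBounded_iff_forall_norm_le]
  -- At M = 1 the defining inequality of `T` reads ‖FY‖² ≤ a tr X, while tr X ≤ c tr(QX) ≤ ca.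
  refine ⟨‖F⁻¹‖ * √(a * (c * a)), fun Y hY => ?_⟩
  have h1 := (hsubT hY).2 1
  simp only [Matrix.conjTranspose_one, Matrix.one_mul, Matrix.mul_one] at h1
  have h2 := (htr _ hY.1.2.posSemidef)
  have h3 := (hle Y hY).1
  have ha : 0 ≤ a := h2.1.trans h3
  have h4 : ‖F * Y‖ ^ 2 ≤ a * (c * a) :=
    h1.trans (mul_le_mul_of_nonneg_left (h2.2.trans (mul_le_mul_of_nonneg_left h3 hc)) ha)
  calc ‖Y‖ = ‖F⁻¹ * (F * Y)‖ := by rw [Matrix.nonsing_inv_mul_cancel_left _ _ hF']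
    _ ≤ ‖F⁻¹‖ * ‖F * Y‖ := Matrix.frobenius_norm_mul _ _
    _ ≤ _ := mul_le_mul_of_nonneg_left (Real.le_sqrt_of_sq_le h4) (norm_nonneg _)

/-- The first-order variation `H - K X'(H)` of the feedback gain `K = Y X(Y)⁻¹` in the direction
`H`, multiplied by `X(Y)`. -/
noncomputable def gainVariation (A : Matrix (Fin n) (Fin n) ℂ) (B : Matrix (Fin n) (Fin m) ℂ)
    (V : Matrix (Fin n) (Fin n) ℂ) (Y H : Matrix (Fin m) (Fin n) ℂ) : Matrix (Fin m) (Fin n) ℂ :=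
  H - Y * (stateCov A B V Y)⁻¹ * stateCovDir A B H

lemma gainVariation_smul (Y H : Matrix (Fin m) (Fin n) ℂ) (r : ℝ) :
    gainVariation A B V Y (r • H) = r • gainVariation A B V Y H := by
  simp only [gainVariation, map_smul, Matrix.mul_smul, smul_sub]

lemma contDiffAt_gainVariation (hA : IsUnit (lyapOp A)) {E : Type*} [NormedAddCommGroup E]
    [NormedSpace ℝ E] {f g : E → Matrix (Fin m) (Fin n) ℂ} {x : E} (hf : ContDiffAt ℝ ⊤ f x)
    (hg : ContDiffAt ℝ ⊤ g x) (hx : f x ∈ stabDomain A B V) :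
    ContDiffAt ℝ ⊤ (fun y => gainVariation A B V (f y) (g y)) x := by
  have hDir : ContDiff ℝ ⊤ (stateCovDir A B) :=
    (ContinuousLinearMap.contDiff (stateCovDir A B).toContinuousLinearMap :)
  have hX : ContDiffAt ℝ ⊤ (fun y => stateCov A B V (f y)) x :=
    ContDiffAt.comp (g := stateCov A B V) x contDiff_stateCov.contDiffAt hf
  have hinv : ContDiffAt ℝ ⊤ (fun y => (stateCov A B V (f y))⁻¹) x :=
    ContDiffAt.comp (g := fun X : Matrix (Fin n) (Fin n) ℂ => X⁻¹)
      (f := fun y => stateCov A B V (f y)) x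
      (contDiffAt_matrix_inv ((mem_stabDomain_iff hA).1 hx).isUnit) hX
  exact hg.sub ((hf.matrix_mul hinv).matrix_mul (hDir.contDiffAt.comp x hg))

/-- A positive continuous function on D × D × unit sphere has a positive lower bound, and both sides
are quadratic in H. Y and W vary independently because the convexity defect takes the gain at the
intermediate point and X at the endpoints. -/
lemma exists_le_matrixFractional_gainVariation (hA : IsUnit (lyapOp A)) (hV : V.PosDef)
    (hR : R.PosDef) {D : Set (Matrix (Fin m) (Fin n) ℂ)} (hDc : IsCompact D)
    (hD : D ⊆ stabDomain A B V) :
    ∃ δ : ℝ, 0 < δ ∧ ∀ Y ∈ D, ∀ W ∈ D, ∀ H, δ * ‖H‖ ^ 2 ≤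
      matrixFractional R (gainVariation A B V W H) (stateCov A B V Y) := by
  have hK : IsCompact (D ×ˢ D ×ˢ Metric.sphere (0 : Matrix (Fin m) (Fin n) ℂ) 1) :=
    hDc.prod (hDc.prod (isCompact_sphere _ _))
  have hcont : ContinuousOn (fun q : Matrix (Fin m) (Fin n) ℂ × Matrix (Fin m) (Fin n) ℂ ×
      Matrix (Fin m) (Fin n) ℂ =>
      matrixFractional R (gainVariation A B V q.2.1 q.2.2) (stateCov A B V q.1))
      (D ×ˢ D ×ˢ Metric.sphere (0 : Matrix (Fin m) (Fin n) ℂ) 1) := by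
    rintro q ⟨hY, hW, -⟩
    refine (contDiffAt_matrixFractional (N := ⊤) R
      (contDiffAt_gainVariation hA (contDiff_fst.comp contDiff_snd).contDiffAt
        (contDiff_snd.comp contDiff_snd).contDiffAt (hD hW))
      (contDiff_stateCov.comp contDiff_fst).contDiffAt
      ((mem_stabDomain_iff hA).1 (hD hY)).isUnit).continuousAt.continuousWithinAt
  obtain ⟨δ, hδ, hbound⟩ := hK.exists_forall_le' hcont (a := 0) (by
    rintro ⟨Y, W, H⟩ ⟨hY, hW, hH⟩
    refine matrixFractional_pos hR (hD hY).2 fun h0 => ?_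
    have : H = 0 := eq_zero_of_eq_gain_mul hA hV (hD hW) (sub_eq_zero.1 h0)
    simp [this] at hH)
  refine ⟨δ, hδ, fun Y hY W hW H => ?_⟩
  rcases eq_or_ne H 0 with rfl | hH
  · simpa using matrixFractional_nonneg hR.posSemidef _ (hD hY).2.posSemidef
  · have hn : ‖H‖ ≠ 0 := norm_ne_zero_iff.2 hH
    have h := hbound (Y, W, ‖H‖⁻¹ • H) ⟨hY, hW, by simp [norm_smul, hn]⟩
    simp only [gainVariation_smul, matrixFractional_smul] at h
    rw [inv_pow, le_inv_mul_iff₀ (by positivity)] at h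
    linarith

theorem exists_strongConvexOn_smoothCost (hA : IsUnit (lyapOp A)) (hV : V.PosDef) (hQ : Q.PosDef)
    (hR : R.PosDef) (a : ℝ) :
    ∃ μ : ℝ, 0 < μ ∧ StrongConvexOn (sublevel A B V Q R a) μ (smoothCost A B V Q R) := by
  obtain ⟨δ, hδ, hlow⟩ := exists_le_matrixFractional_gainVariation hA hV hR
    (isCompact_sublevel hA hV hQ hR a) (fun Y hY => hY.1)
  -- Strong convexity with modulus μ asks for μ/2 in front of st‖Y - Z‖².
  refine ⟨2 * δ, by positivity, convex_sublevel hA hR a, ?_⟩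
  intro Y hY Z hZ s t hs ht hst
  have hW := convex_sublevel hA hR a hY hZ hs ht hst
  have h := smoothCost_convexity_defect (Q := Q) hA hR.isHermitian hY.1 hZ.1 hs ht hst
    (E := gainVariation A B V (s • Y + t • Z) (Y - Z)) rfl
  have h1 := mul_le_mul_of_nonneg_left (hlow Y hY _ hW (Y - Z)) ht
  have h2 := mul_le_mul_of_nonneg_left (hlow Z hZ _ hW (Y - Z)) hs
  have h3 := mul_le_mul_of_nonneg_left (add_le_add h1 h2) (mul_nonneg hs ht)
  have h4 : t * (δ * ‖Y - Z‖ ^ 2) + s * (δ * ‖Y - Z‖ ^ 2) = δ * ‖Y - Z‖ ^ 2 := by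
    rw [← add_mul, add_comm t s, hst, one_mul]
  rw [h4] at h3
  simp only [smul_eq_mul]
  have h5 : 2 * δ / 2 * ‖Y - Z‖ ^ 2 = δ * ‖Y - Z‖ ^ 2 := by ring
  rw [h5]
  linarith

/-! ### The gradient -/

attribute [local instance] frobeniusInnerProductSpace

lemma hasFDerivAt_innerSL_matGrad {f : Matrix (Fin m) (Fin n) ℂ → ℝ}
    {Y : Matrix (Fin m) (Fin n) ℂ} (hf : DifferentiableAt ℝ f Y) :
    HasFDerivAt f (innerSL ℝ (matGrad f Y)) Y := by
  have : innerSL ℝ (matGrad f Y) = fderiv ℝ f Y := by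
    ext1 H
    exact re_trace_matGrad f Y H
  rw [this]
  exact hf.hasFDerivAt

lemma norm_matGrad_sub_le {f : Matrix (Fin m) (Fin n) ℂ → ℝ} {Y Z : Matrix (Fin m) (Fin n) ℂ}
    {c : ℝ} (hc : 0 ≤ c) (h : ∀ H, |fderiv ℝ f Y H - fderiv ℝ f Z H| ≤ c * ‖H‖) :
    ‖matGrad f Y - matGrad f Z‖ ≤ c := by
  set G := matGrad f Y - matGrad f Z with hG
  have h1 : ‖G‖ ^ 2 = fderiv ℝ f Y G - fderiv ℝ f Z G := by
    rw [frobenius_norm_sq_eq_re_trace, ← re_trace_matGrad f Y, ← re_trace_matGrad f Z,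
      ← Complex.sub_re, ← Matrix.trace_sub, ← Matrix.sub_mul, ← Matrix.conjTranspose_sub]
  -- The derivative difference is tested in the direction of the gradient difference itself.
  have h2 := (le_abs_self _).trans (h G)
  rw [← h1] at h2
  rcases (norm_nonneg G).eq_or_lt with h0 | h0
  · rwa [← h0]
  · exact le_of_mul_le_mul_right (by rwa [← sq]) h0

/-- A `C²` function has a Lipschitz derivative on a compact convex set. -/
lemma exists_fderiv_lipschitz_of_contDiffAt {E : Type*} [NormedAddCommGroup E] [NormedSpace ℝ E]
    {f : E → ℝ} {s : Set E} (hs : IsCompact s) (hconv : Convex ℝ s)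
    (hf : ∀ x ∈ s, ContDiffAt ℝ 2 f x) :
    ∃ C : ℝ, 0 < C ∧ ∀ x ∈ s, ∀ y ∈ s, ∀ v,
      |fderiv ℝ f x v - fderiv ℝ f y v| ≤ C * ‖x - y‖ * ‖v‖ := by
  have hd : ∀ x ∈ s, ContDiffAt ℝ 1 (fderiv ℝ f) x :=
    fun x hx => (hf x hx).fderiv_right (m := 1) (by norm_num)
  have hdd : ContinuousOn (fun x => ‖fderiv ℝ (fderiv ℝ f) x‖) s := fun x hx =>
    ((hd x hx).fderiv_right (m := 0) (by norm_num)).continuousAt.norm.continuousWithinAt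
  obtain ⟨C, hC⟩ := hs.exists_bound_of_continuousOn hdd
  refine ⟨max C 1, by positivity, fun x hx y hy v => ?_⟩
  have h := hconv.norm_image_sub_le_of_norm_fderiv_le
    (fun w hw => (hd w hw).differentiableAt (by norm_num))
    (fun w hw => (norm_norm (fderiv ℝ (fderiv ℝ f) w) ▸ hC w hw).trans (le_max_left C 1)) hy hx
  exact ((fderiv ℝ f x - fderiv ℝ f y).le_opNorm v).trans
    (mul_le_mul_of_nonneg_right h (norm_nonneg v))

theorem exists_isSmoothOn_smoothCost (hA : IsUnit (lyapOp A)) (hV : V.PosDef) (hQ : Q.PosDef)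
    (hR : R.PosDef) (a : ℝ) :
    ∃ L : ℝ, 0 < L ∧ IsSmoothOn (smoothCost A B V Q R) (sublevel A B V Q R a) L := by
  have hsm : ∀ Y ∈ sublevel A B V Q R a, ContDiffAt ℝ 2 (smoothCost A B V Q R) Y :=
    fun Y hY => (contDiffAt_smoothCost hA hY.1).of_le le_top
  obtain ⟨L, hL, hlip⟩ := exists_fderiv_lipschitz_of_contDiffAt
    (isCompact_sublevel hA hV hQ hR a) (convex_sublevel hA hR a) hsm
  exact ⟨L, hL, fun Y hY => (hsm Y hY).differentiableAt (by norm_num),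
    fun Y hY Z hZ => norm_matGrad_sub_le (by positivity) (hlip Y hY Z hZ)⟩

/-! ### The regularizer and the optimal solution -/

lemma rowReg_nonneg {w : Fin m → ℝ} (hw : ∀ i, 0 ≤ w i) (Y : Matrix (Fin m) (Fin n) ℂ) :
    0 ≤ rowReg w Y :=
  Finset.sum_nonneg fun i _ => mul_nonneg (hw i) (norm_nonneg _)

lemma continuous_rowReg (w : Fin m → ℝ) :
    Continuous (rowReg w : Matrix (Fin m) (Fin n) ℂ → ℝ) := by
  unfold rowReg
  refine continuous_finsetSum _ fun i _ => continuous_const.mul (Continuous.norm ?_)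
  exact (PiLp.continuous_toLp 2 _).comp (continuous_apply i)

lemma convexOn_rowReg {w : Fin m → ℝ} (hw : ∀ i, 0 ≤ w i) :
    ConvexOn ℝ univ (rowReg w : Matrix (Fin m) (Fin n) ℂ → ℝ) := by
  refine ⟨convex_univ, fun Y _ Z _ s t hs ht _ => ?_⟩
  simp only [rowReg, smul_eq_mul, Finset.mul_sum, ← Finset.sum_add_distrib]
  refine Finset.sum_le_sum fun i _ => ?_
  have h1 : (WithLp.toLp 2 ((s • Y + t • Z) i) : EuclideanSpace ℂ (Fin n)) =
      s • WithLp.toLp 2 (Y i) + t • WithLp.toLp 2 (Z i) := rfl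
  have h2 : ‖(WithLp.toLp 2 ((s • Y + t • Z) i) : EuclideanSpace ℂ (Fin n))‖ ≤
      s * ‖(WithLp.toLp 2 (Y i) : EuclideanSpace ℂ (Fin n))‖ +
      t * ‖(WithLp.toLp 2 (Z i) : EuclideanSpace ℂ (Fin n))‖ := by
    rw [h1]
    refine (norm_add_le _ _).trans ?_
    rw [norm_smul, norm_smul, Real.norm_of_nonneg hs, Real.norm_of_nonneg ht]
  have := mul_le_mul_of_nonneg_left h2 (hw i)
  linarith

theorem existsUnique_isSolution (hA : IsUnit (lyapOp A)) (hV : V.PosDef) (hQ : Q.PosDef)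
    (hR : R.PosDef) {g : Matrix (Fin m) (Fin n) ℂ → ℝ} (hg : ConvexOn ℝ univ g)
    (hgc : Continuous g) (hg0 : ∀ Z, 0 ≤ g Z) {γ a : ℝ} (hγ : 0 ≤ γ)
    {Y0 : Matrix (Fin m) (Fin n) ℂ} (hY0 : Y0 ∈ stabDomain A B V)
    (ha : smoothCost A B V Q R Y0 + γ * g Y0 ≤ a) :
    ∃! Ys, IsSolution (smoothCost A B V Q R) g γ (stabDomain A B V) Ys := by
  set f := smoothCost A B V Q R with hf
  set D := sublevel A B V Q R a with hD
  have hγg : ∀ Z, 0 ≤ γ * g Z := fun Z => mul_nonneg hγ (hg0 Z)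
  have hY0D : Y0 ∈ D := ⟨hY0, by linarith [hγg Y0]⟩
  have hcont : ContinuousOn (fun Z => f Z + γ * g Z) D := fun Y hY =>
    ((contDiffAt_smoothCost hA hY.1).continuousAt.add
      (continuous_const.mul hgc).continuousAt).continuousWithinAt
  obtain ⟨Ys, hYs, hmin⟩ :=
    (isCompact_sublevel hA hV hQ hR a).exists_isMinOn ⟨Y0, hY0D⟩ hcont
  have hmin0 : f Ys + γ * g Ys ≤ f Y0 + γ * g Y0 := hmin hY0D
  have hsol : IsSolution f g γ (stabDomain A B V) Ys := by
    refine ⟨hYs.1, fun Z hZ => ?_⟩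
    -- Outside the sublevel set f alone exceeds a, which bounds the objective at Y0, so the
    -- minimizer on the compact set is global.
    by_cases hZa : f Z ≤ a
    · exact hmin (show Z ∈ D from ⟨hZ, hZa⟩)
    · change f Ys + γ * g Ys ≤ f Z + γ * g Z
      linarith [hγg Z]
  refine ⟨Ys, hsol, fun Z hZ => ?_⟩
  have hZ0 : f Z + γ * g Z ≤ f Y0 + γ * g Y0 := hZ.2 hY0
  have hZD : Z ∈ D := ⟨hZ.1, by linarith [hγg Z]⟩
  obtain ⟨μ, hμ, hconv⟩ := exists_strongConvexOn_smoothCost hA hV hQ hR a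
  have hhalf : (0 : ℝ) ≤ 1 / 2 := by norm_num
  have hsum : (1 / 2 : ℝ) + 1 / 2 = 1 := by norm_num
  have h1 := hconv.2 hYs hZD hhalf hhalf hsum
  have h2 := hg.2 (mem_univ Ys) (mem_univ Z) hhalf hhalf hsum
  have h3 := hsol.2 hZ.1
  -- The midpoint of two minimizers is feasible; strong convexity would make it strictly better if
  -- they differed.
  have h4 := hZ.2 (convex_stabDomain hA hYs.1 hZ.1 hhalf hhalf hsum)
  have h5 := hZ.2 hYs.1
  simp only [mem_ofPred_eq, smul_eq_mul] at h1 h2 h3 h4 h5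
  have h6 := mul_le_mul_of_nonneg_left h2 hγ
  have h7 : μ * ‖Ys - Z‖ ^ 2 ≤ 0 := by nlinarith
  have h8 : ‖Ys - Z‖ ^ 2 ≤ 0 := by
    by_contra! h
    linarith [mul_pos hμ h]
  have h9 : ‖Ys - Z‖ = 0 := by nlinarith [norm_nonneg (Ys - Z)]
  exact (sub_eq_zero.1 (norm_eq_zero.1 h9)).symm

lemma existsUnique_isProx {h : Matrix (Fin m) (Fin n) ℂ → ℝ} (hc : ConvexOn ℝ univ h)
    (hcont : Continuous h) (h0 : ∀ Z, 0 ≤ h Z) (W : Matrix (Fin m) (Fin n) ℂ) :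
    ∃! P, IsProx h W P := by
  simp only [IsProx, isMinOn_univ_iff]
  obtain ⟨P, hP⟩ := prox_exists hcont h0 W
  exact ⟨P, hP, fun P' hP' => prox_unique hc hP hP'⟩

lemma existsUnique_isProxGradSeq {f g : Matrix (Fin m) (Fin n) ℂ → ℝ} (hg : ConvexOn ℝ univ g)
    (hgc : Continuous g) (hg0 : ∀ Z, 0 ≤ g Z) {γ α : ℝ} (hγα : 0 ≤ γ * α)
    (Y0 : Matrix (Fin m) (Fin n) ℂ) : ∃! Y, IsProxGradSeq f g γ α Y0 Y := by
  have hprox := existsUnique_isProx (hg.smul hγα) (continuous_const.mul hgc)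
    (fun Z => mul_nonneg hγα (hg0 Z))
  choose p hp hpu using hprox
  refine ⟨fun k => Nat.rec Y0 (fun _ Y => p (Y - α • matGrad f Y)) k, ⟨rfl, fun k => hp _⟩, ?_⟩
  rintro Y ⟨h0, hstep⟩
  funext k
  induction k with
  | zero => exact h0
  | succ k ih => rw [hpu _ _ (hstep k), ih]

theorem proxGradSeq_step (hA : IsUnit (lyapOp A)) (hV : V.PosDef) (hQ : Q.PosDef) (hR : R.PosDef)
    {g : Matrix (Fin m) (Fin n) ℂ → ℝ} (hg : ConvexOn ℝ univ g) (hg0 : ∀ Z, 0 ≤ g Z)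
    {γ a μ L α : ℝ} (hγ : 0 ≤ γ) (hL : 0 < L)
    (hconv : StrongConvexOn (sublevel A B V Q R a) μ (smoothCost A B V Q R))
    (hsm : IsSmoothOn (smoothCost A B V Q R) (sublevel A B V Q R a) L)
    (hα : 0 ≤ α) (hαL : α ≤ 1 / L) {Y P : Matrix (Fin m) (Fin n) ℂ} (hY : Y ∈ stabDomain A B V)
    (hYa : smoothCost A B V Q R Y + γ * g Y < a)
    (hP : IsProx (fun Z => γ * α * g Z) (Y - α • matGrad (smoothCost A B V Q R) Y) P) :
    P ∈ stabDomain A B V ∧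
      smoothCost A B V Q R P + γ * g P ≤ smoothCost A B V Q R Y + γ * g Y ∧
      ∀ Ys ∈ sublevel A B V Q R a,
        smoothCost A B V Q R Ys + γ * g Ys ≤ smoothCost A B V Q R P + γ * g P →
        ‖P - Ys‖ ^ 2 ≤ (1 - μ * α) * ‖Y - Ys‖ ^ 2 := by
  refine proximal_gradient_step (g := fun Z => γ * g Z)
    (isOpen_stabDomain hA hV.isHermitian) (isCompact_sublevel hA hV hQ hR a).isClosed
    (fun Z hZ => hasFDerivAt_innerSL_matGrad (hsm.1 Z hZ)) hsm.2 hconv (hg.smul hγ)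
    (fun Z => mul_nonneg hγ (hg0 Z)) hα ((le_div_iff₀ hL).1 hαL) hY hYa fun Z => ?_
  have := isMinOn_univ_iff.1 hP Z
  simpa only [mul_assoc, mul_left_comm α γ] using this

end ActuatorProblem

/-! ### The main theorem. -/

theorem theorem1 {m n : ℕ}
    (A : Matrix (Fin n) (Fin n) ℂ) (B : Matrix (Fin n) (Fin m) ℂ)
    (V Q : Matrix (Fin n) (Fin n) ℂ) (R : Matrix (Fin m) (Fin m) ℂ)
    (w : Fin m → ℝ) (γ : ℝ)
    (hA : IsUnit (lyapOp A))
    (hV : V.PosDef) (hQ : Q.PosDef) (hR : R.PosDef)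
    (hw : ∀ i, 0 < w i) (hγ : 0 < γ)
    (Y0 : Matrix (Fin m) (Fin n) ℂ) (hY0 : Y0 ∈ stabDomain A B V)
    (a : ℝ)
    (ha : smoothCost A B V Q R Y0 + γ * rowReg w Y0 < a) :
    (∃ μ : ℝ, 0 < μ ∧
      StrongConvexOn (sublevel A B V Q R a) μ
        (smoothCost A B V Q R)) ∧
    (∃ L : ℝ, 0 < L ∧
      IsSmoothOn (smoothCost A B V Q R)
        (sublevel A B V Q R a) L) ∧
    (∃! Ys : Matrix (Fin m) (Fin n) ℂ,
      IsSolution (smoothCost A B V Q R)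
        (rowReg w) γ (stabDomain A B V) Ys) ∧
    ∀ μ L α : ℝ, 0 < μ → 0 < L →
      StrongConvexOn (sublevel A B V Q R a) μ
        (smoothCost A B V Q R) →
      IsSmoothOn (smoothCost A B V Q R)
        (sublevel A B V Q R a) L →
      0 ≤ α → α ≤ 1 / L →
      (∃! Y : ℕ → Matrix (Fin m) (Fin n) ℂ,
        IsProxGradSeq (smoothCost A B V Q R)
          (rowReg w) γ α Y0 Y) ∧
      ∀ Y : ℕ → Matrix (Fin m) (Fin n) ℂ,
        IsProxGradSeq (smoothCost A B V Q R)
          (rowReg w) γ α Y0 Y →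
        ∀ Ys : Matrix (Fin m) (Fin n) ℂ,
          IsSolution (smoothCost A B V Q R)
            (rowReg w) γ (stabDomain A B V) Ys →
          ∀ k : ℕ, Y k ∈ sublevel A B V Q R a ∧
            ‖Y (k + 1) - Ys‖ ^ 2 ≤ (1 - μ * α) * ‖Y k - Ys‖ ^ 2 := by
  have hw0 : ∀ i, 0 ≤ w i := fun i => (hw i).le
  have hg := convexOn_rowReg (n := n) hw0
  have hgc := continuous_rowReg (n := n) w
  have hg0 := rowReg_nonneg (n := n) hw0
  refine ⟨exists_strongConvexOn_smoothCost hA hV hQ hR a, exists_isSmoothOn_smoothCost hA hV hQ hR a,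
    existsUnique_isSolution hA hV hQ hR hg hgc hg0 hγ.le hY0 ha.le, ?_⟩
  intro μ L α hμ hL hconv hsm hα hαL
  refine ⟨existsUnique_isProxGradSeq hg hgc hg0 (mul_nonneg hγ.le hα) Y0, ?_⟩
  rintro Y ⟨hY, hstep⟩ Ys hYs
  -- The invariant is the strict bound on the whole objective, stronger than lying in the sublevel
  -- set: the continuation argument needs it at every step.
  have hstay : ∀ k, Y k ∈ stabDomain A B V ∧
      smoothCost A B V Q R (Y k) + γ * rowReg w (Y k) < a := by
    intro k
    induction k with
    | zero => rw [hY]; exact ⟨hY0, ha⟩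
    | succ k ih =>
      have h := proxGradSeq_step hA hV hQ hR hg hg0 hγ.le hL hconv hsm hα hαL ih.1 ih.2 (hstep k)
      exact ⟨h.1, h.2.1.trans_lt ih.2⟩
  have hmem : ∀ Z ∈ stabDomain A B V, smoothCost A B V Q R Z + γ * rowReg w Z < a →
      Z ∈ sublevel A B V Q R a := fun Z hZ hlt =>
    ⟨hZ, by linarith [mul_nonneg hγ.le (hg0 Z)]⟩
  intro k
  refine ⟨hmem _ (hstay k).1 (hstay k).2, ?_⟩
  have h := proxGradSeq_step hA hV hQ hR hg hg0 hγ.le hL hconv hsm hα hαL (hstay k).1 (hstay k).2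
    (hstep k)
  exact h.2.2 Ys (hmem Ys hYs.1 (lt_of_le_of_lt (hYs.2 hY0) ha)) (hYs.2 h.1)
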